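/- All graphs are finite and simple; $\delta$ and $\Delta$ denote minimum and maximum degree. Let $k\ge 1$ and $n \ge \max\{6k^3,\,120k^2-180k+60\}$ be integers. Then every graph $F$ of order $n$ with $\delta(F)\ge n-k$ contains, as a (not necessarily induced, spanning) subgraph, a copy of every connected graph $G$ with $n$ vertices, at most $n\left(1+\frac{1}{24k-12}\right)$ edges and $\Delta(G) < n\left(1-\frac{1}{24k-12}\right)$. -/

import Mathlib

/-! Pass to the complement: `H = Fᶜ` has maximum degree at most `D = k - 1`, and a bijection sending
no edge of `H` to an edge of `G` is wanted. Connectivity of `G` serves only to exclude isolated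
vertices. With `m = n / (24k - 12)`, the edge bound then says that the excesses `deg - 1` in `G` sum
to at most `n + 2m`.

Hence at most `3D` vertices of `G` have degree above `n / (3D)`. These and a vertex of maximum
degree form `B`. They are placed on vertices of `H` with disjoint closed neighbourhoods, and the
`H`-neighbours of these places receive an independent set of `G`, each member not adjacent to the
vertex of `B` it sits beside (`exists_fillers`). This partial packing is frozen. All other vertices
have small degree, so swaps remove the remaining conflicts
(`exists_equiv_forall_not_adj_of_switching`). -/

open Finset in
/-- Greedy choice of representatives that are pairwise unrelated, and unrelated to a given set. -/
theorem exists_pairwise_unrelated_choice {ι α : Type*} [DecidableEq ι] [DecidableEq α] [Fintype α]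
    (R : α → α → Prop) [DecidableRel R] (hsymm : ∀ a b, R a b → R b a) (c : ℕ) (T I₀ : Finset α)
    (hR : ∀ a ∈ T, #{y | R a y} ≤ c) (hI₀ : I₀ ⊆ T) (A : ι → Finset α) (X : Finset ι)
    (hAT : ∀ i ∈ X, A i ⊆ T) (hA : ∀ i ∈ X, c * (#X + #I₀) < #(A i)) (p₀ : ι → α) :
    ∃ p : ι → α, (∀ i ∈ X, p i ∈ A i) ∧ (∀ i ∈ X, ∀ j ∈ X, i ≠ j → ¬ R (p i) (p j)) ∧
      ∀ i ∈ X, ∀ a ∈ I₀, ¬ R a (p i) := by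
  induction X using Finset.induction_on with
  | empty => exact ⟨p₀, by simp⟩
  | insert i X hi ih =>
    obtain ⟨p, hp1, hp2, hp3⟩ := ih (fun j hj => hAT j (mem_insert_of_mem hj)) (fun j hj =>
      lt_of_le_of_lt (Nat.mul_le_mul_left _ (by simp [card_insert_of_notMem hi]))
        (hA j (mem_insert_of_mem hj)))
    have hcard : #((X.image p ∪ I₀).biUnion fun a => {y | R a y}) < #(A i) := by
      refine lt_of_le_of_lt (card_biUnion_le_card_mul _ _ c ?_)
        (lt_of_le_of_lt ?_ (hA i (mem_insert_self i X)))
      · intro a ha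
        refine hR a ?_
        rcases mem_union.1 ha with ha | ha
        · obtain ⟨j, hj, rfl⟩ := mem_image.1 ha
          exact hAT j (mem_insert_of_mem hj) (hp1 j hj)
        · exact hI₀ ha
      · rw [mul_comm]
        refine Nat.mul_le_mul_left _ ((card_union_le _ _).trans ?_)
        have := card_image_le (s := X) (f := p)
        rw [card_insert_of_notMem hi]
        omega
    obtain ⟨a, haA, ha⟩ := exists_mem_notMem_of_card_lt_card hcard
    simp only [mem_biUnion, mem_union, mem_image, mem_filter, mem_univ, true_and, not_exists,
      not_and] at ha
    have hne : ∀ j ∈ X, j ≠ i := fun j hj h => hi (h ▸ hj)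
    refine ⟨Function.update p i a, ?_, ?_, ?_⟩
    · intro j hj
      rcases mem_insert.1 hj with rfl | hj
      · simpa using haA
      · simpa [hne j hj] using hp1 j hj
    · intro j hj l hl hjl
      rcases mem_insert.1 hj with h1 | h1 <;> rcases mem_insert.1 hl with h2 | h2
      · exact absurd (h1.trans h2.symm) hjl
      · simpa [h1, hne l h2] using fun h => ha (p l) (Or.inl ⟨l, h2, rfl⟩) (hsymm _ _ h)
      · simpa [h2, hne j h1] using ha (p j) (Or.inl ⟨j, h1, rfl⟩)
      · simpa [hne j h1, hne l h2] using hp2 j h1 l h2 hjl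
    · intro j hj b hb
      rcases mem_insert.1 hj with rfl | hj
      · simpa using ha b (Or.inr hb)
      · simpa [hne j hj] using hp3 j hj b hb

/-! ### Independent sets and switching. -/

namespace SimpleGraph

open Finset in
/-- The Caro–Wei bound for the independent sets inside a given set of vertices. -/
theorem exists_isIndepSet_sum_inv_degree_le {W : Type*} [Fintype W] [DecidableEq W]
    (G : SimpleGraph W) [DecidableRel G.Adj] (N : Finset W) :
    ∃ I ⊆ N, G.IsIndepSet I ∧ ∑ v ∈ N, (1 : ℝ) / (G.degree v + 1) ≤ #I := by
  induction N using Finset.strongInduction with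
  | H N ih =>
    rcases N.eq_empty_or_nonempty with rfl | hN
    · exact ⟨∅, by simp⟩
    -- As `v` has least degree in `N`, deleting its closed neighbourhood removes total weight at
    -- most 1.
    obtain ⟨v, hv, hmin⟩ := exists_min_image N (fun w => G.degree w) hN
    set C := insert v (G.neighborFinset v) with hC
    have hCcard : #C = G.degree v + 1 := by
      rw [hC, card_insert_of_notMem (by simp), card_neighborFinset_eq_degree]
    obtain ⟨I, hIN, hI, hle⟩ := ih (N \ C)
      ((ssubset_iff_of_subset sdiff_subset).2 ⟨v, hv, by simp [hC]⟩)
    have hvI : ∀ w ∈ I, w ≠ v ∧ ¬ G.Adj v w := fun w hw => by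
      simpa [hC] using (mem_sdiff.1 (hIN hw)).2
    have hvn : v ∉ I := fun h => (hvI v h).1 rfl
    refine ⟨insert v I, insert_subset hv (hIN.trans sdiff_subset), ?_, ?_⟩
    · intro a ha b hb hab
      simp only [coe_insert, Set.mem_insert_iff, mem_coe] at ha hb
      rcases ha with rfl | ha <;> rcases hb with rfl | hb
      · exact absurd rfl hab
      · exact (hvI b hb).2
      · exact fun h => (hvI a ha).2 h.symm
      · exact hI ha hb hab
    · have h1 : ∑ w ∈ N ∩ C, (1 : ℝ) / (G.degree w + 1) ≤ 1 := by
        calc ∑ w ∈ N ∩ C, (1 : ℝ) / (G.degree w + 1)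
            ≤ ∑ w ∈ N ∩ C, (1 : ℝ) / (G.degree v + 1) := by
              refine sum_le_sum fun w hw => ?_
              have := hmin w (mem_inter.1 hw).1
              gcongr
          _ = #(N ∩ C) * ((1 : ℝ) / (G.degree v + 1)) := by simp
          _ ≤ (G.degree v + 1) * ((1 : ℝ) / (G.degree v + 1)) := by
              have : #(N ∩ C) ≤ G.degree v + 1 := hCcard ▸ card_le_card inter_subset_right
              gcongr
              exact_mod_cast this
          _ = 1 := by field_simp
      rw [← sum_inter_add_sum_sdiff N C, card_insert_of_notMem hvn]
      push_cast
      linarith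

open Finset in
/-- Sauer–Spencer switching: a bijection without conflicts inside `Y` can be changed outside `Y`
so as to have no conflicts at all, if the degrees met outside `Y` are small. -/
theorem exists_equiv_forall_not_adj_of_switching {V W : Type*} [Fintype V] [DecidableEq V]
    [Fintype W] [DecidableEq W] (H : SimpleGraph V) [DecidableRel H.Adj] (G : SimpleGraph W)
    [DecidableRel G.Adj] (D s : ℕ) (hH : ∀ x, H.degree x ≤ D) (Y : Finset V) (B : Finset W)
    (hB : ∀ w ∉ B, G.degree w ≤ s) (hcard : 2 * (D * s) + #Y + D < Fintype.card V)
    (e₀ : V ≃ W) (hY : ∀ x ∈ Y, ∀ y ∈ Y, H.Adj x y → ¬ G.Adj (e₀ x) (e₀ y))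
    (hYB : ∀ x, e₀ x ∈ B → x ∈ Y) (hnY : ∀ x, e₀ x ∈ B → ∀ y, H.Adj x y → y ∈ Y) :
    ∃ e : V ≃ W, ∀ x y, H.Adj x y → ¬ G.Adj (e x) (e y) := by
  let E : Finset (V ≃ W) := {e | ∀ x ∈ Y, e x = e₀ x}
  let conf : (V ≃ W) → Finset (V × V) := fun e => {q | H.Adj q.1 q.2 ∧ G.Adj (e q.1) (e q.2)}
  obtain ⟨e, he, hmin⟩ := exists_min_image E (fun e => #(conf e)) ⟨e₀, by simp [E]⟩
  have he' : ∀ x ∈ Y, e x = e₀ x := by simpa [E] using he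
  have hBY : ∀ x, e x ∈ B → x ∈ Y ∧ e₀ x = e x := by
    intro x hx
    have h1 : e₀.symm (e x) ∈ Y := hYB _ (by simpa using hx)
    have h2 := he' _ h1
    rw [Equiv.apply_symm_apply] at h2
    have h3 : e₀.symm (e x) = x := e.injective h2
    rw [h3] at h1
    exact ⟨h1, (he' x h1).symm⟩
  refine ⟨e, ?_⟩
  by_contra! hcon
  obtain ⟨u, v, huv, hGuv, huY⟩ : ∃ u v, H.Adj u v ∧ G.Adj (e u) (e v) ∧ u ∉ Y := by
    obtain ⟨x, y, hxy, hG⟩ := hcon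
    by_cases hx : x ∈ Y
    · by_cases hy : y ∈ Y
      · exact absurd (by rw [← he' x hx, ← he' y hy]; exact hG) (hY x hx y hy hxy)
      · exact ⟨y, x, hxy.symm, hG.symm, hy⟩
    · exact ⟨x, y, hxy, hG, hx⟩
  -- Since `u ∉ Y`, neither `u` nor any `H`-neighbour of `u` carries a vertex of `B`.
  have hdegu : G.degree (e u) ≤ s := hB _ fun h => huY (hBY u h).1
  have hdegN : ∀ x, H.Adj u x → G.degree (e x) ≤ s := fun x hx => hB _ fun h =>
    huY (hnY x (by rw [(hBY x h).2]; exact h) u hx.symm)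
  -- Swapping the images of `u` and `w` could create a conflict at `w` only if `w ∈ W₁`, and at `u`
  -- only if `w ∈ W₂`, provided `u` and `w` are not `H`-adjacent.
  let W₁ := (G.neighborFinset (e u)).biUnion fun z => H.neighborFinset (e.symm z)
  let W₂ := (H.neighborFinset u).biUnion fun x => (G.neighborFinset (e x)).map e.symm.toEmbedding
  have hW₁ : #W₁ ≤ D * s := by
    refine (card_biUnion_le_card_mul _ _ D fun z _ => by simpa using hH _).trans ?_
    rw [mul_comm, card_neighborFinset_eq_degree]
    exact Nat.mul_le_mul_left _ hdegu
  have hW₂ : #W₂ ≤ D * s := by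
    refine (card_biUnion_le_card_mul _ _ s fun x hx => ?_).trans ?_
    · simpa using hdegN x (by simpa using hx)
    · rw [card_neighborFinset_eq_degree]
      exact Nat.mul_le_mul_right _ (hH u)
  have hbad : #(W₁ ∪ W₂ ∪ Y ∪ H.neighborFinset u) < #(univ : Finset V) := by
    have h1 := card_union_le (W₁ ∪ W₂ ∪ Y) (H.neighborFinset u)
    have h2 := card_union_le (W₁ ∪ W₂) Y
    have h3 := card_union_le W₁ W₂
    have h4 := hH u
    rw [card_neighborFinset_eq_degree] at h1
    rw [card_univ]
    omega
  obtain ⟨w, -, hw⟩ := exists_mem_notMem_of_card_lt_card hbad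
  simp only [W₁, W₂, mem_union, mem_biUnion, mem_neighborFinset, mem_map_equiv, Equiv.symm_symm,
    not_or, not_exists, not_and] at hw
  obtain ⟨⟨⟨hw1, hw2⟩, hwY⟩, hwu⟩ := hw
  have hw1' : ∀ x, G.Adj (e u) (e x) → ¬ H.Adj x w := fun x hx => by simpa using hw1 (e x) hx
  have hwne : w ≠ u := fun h => hw1' v hGuv (h ▸ huv.symm)
  let e' : V ≃ W := (Equiv.swap u w).trans e
  have heu : e' u = e w := by simp [e']
  have hew : e' w = e u := by simp [e']
  have heo : ∀ x, x ≠ u → x ≠ w → e' x = e x := fun x h1 h2 => by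
    simp [e', Equiv.swap_apply_of_ne_of_ne h1 h2]
  have hnou : ∀ x, H.Adj u x → ¬ G.Adj (e' u) (e' x) := by
    intro x hx hG
    have hxw : x ≠ w := fun h => hwu (h ▸ hx)
    rw [heu, heo x hx.ne' hxw] at hG
    exact hw2 x hx hG.symm
  have hnow : ∀ x, H.Adj w x → ¬ G.Adj (e' w) (e' x) := by
    intro x hx hG
    have hxu : x ≠ u := fun h => hwu (h ▸ hx.symm)
    rw [hew, heo x hxu hx.ne'] at hG
    exact hw1' x hG hx.symm
  have he'E : e' ∈ E := by
    simp only [E, mem_filter, mem_univ, true_and]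
    intro x hx
    rw [heo x (fun h => huY (h ▸ hx)) (fun h => hwY (h ▸ hx)), he' x hx]
  refine absurd (hmin e' he'E) (not_le.2 (card_lt_card ?_))
  refine (ssubset_iff_of_subset ?_).2 ⟨(u, v), by simp [conf, huv, hGuv], ?_⟩
  · rintro ⟨x, y⟩ hxy
    simp only [conf, mem_filter, mem_univ, true_and] at hxy ⊢
    obtain ⟨h1, h2⟩ := hxy
    have hxu : x ≠ u := by rintro rfl; exact hnou y h1 h2
    have hxw : x ≠ w := by rintro rfl; exact hnow y h1 h2
    have hyu : y ≠ u := by rintro rfl; exact hnou x h1.symm h2.symm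
    have hyw : y ≠ w := by rintro rfl; exact hnow x h1.symm h2.symm
    exact ⟨h1, by rwa [heo x hxu hxw, heo y hyu hyw] at h2⟩
  · simp only [conf, mem_filter, mem_univ, true_and, not_and]
    exact hnou v

open Finset

/-! ### Independent sets of `G` to surround the vertices of `B`. -/

section Fillers

variable {V W : Type*} [Fintype W] (G : SimpleGraph W) [DecidableRel G.Adj] {D n : ℕ} {m : ℝ}

/-- Every excess is nonnegative, so the bound for all vertices passes to any subset. -/
theorem sum_degree_sub_one_le (hW : Fintype.card W = n) (hG1 : ∀ w, 1 ≤ G.degree w)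
    (hsum : ∑ w, (G.degree w : ℝ) ≤ 2 * n + 2 * m) (T : Finset W) :
    ∑ w ∈ T, ((G.degree w : ℝ) - 1) ≤ n + 2 * m := by
  have h1 : ∑ w ∈ T, ((G.degree w : ℝ) - 1) ≤ ∑ w, ((G.degree w : ℝ) - 1) :=
    sum_le_sum_of_subset_of_nonneg (subset_univ T) fun w _ _ => by
      have : (1 : ℝ) ≤ G.degree w := by exact_mod_cast hG1 w
      linarith
  have h2 : ∑ w, ((G.degree w : ℝ) - 1) = ∑ w, (G.degree w : ℝ) - n := by
    rw [sum_sub_distrib]; simp [hW]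
  linarith

variable [DecidableEq V] [DecidableEq W]

theorem card_filter_ne_not_adj_add_degree (b : W) :
    #{v | v ≠ b ∧ ¬ G.Adj b v} + G.degree b + 1 = Fintype.card W := by
  have h := card_filter_add_card_filter_not (s := (univ : Finset W)) (fun v => v ≠ b ∧ ¬ G.Adj b v)
  have h2 : ({v | ¬ (v ≠ b ∧ ¬ G.Adj b v)} : Finset W) = insert b (G.neighborFinset b) := by
    ext v
    simp only [mem_filter, mem_univ, true_and, mem_insert, mem_neighborFinset]
    tauto
  rw [h2, card_insert_of_notMem (by simp), card_neighborFinset_eq_degree, card_univ] at h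
  omega

/-- Many vertices of degree at most four are not adjacent to a given vertex. -/
theorem le_card_degree_le_four_not_adj (hW : Fintype.card W = n) (hG1 : ∀ w, 1 ≤ G.degree w)
    (hsum : ∑ w, (G.degree w : ℝ) ≤ 2 * n + 2 * m) (b : W) :
    3 * (n : ℝ) - 5 - 3 * G.degree b - 2 * m ≤ 4 * #{v | G.degree v ≤ 4 ∧ ¬ G.Adj b v} := by
  set N : Finset W := {v | v ≠ b ∧ ¬ G.Adj b v} with hN
  have h1 := G.card_filter_ne_not_adj_add_degree b
  rw [hW, ← hN] at h1
  have h2 := card_filter_add_card_filter_not (s := N) (fun v => G.degree v ≤ 4)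
  have h3 : #(N.filter fun v => G.degree v ≤ 4) ≤ #{v | G.degree v ≤ 4 ∧ ¬ G.Adj b v} := by
    refine card_le_card fun v => ?_
    simp only [hN, mem_filter, mem_univ, true_and]
    tauto
  set L := N.filter fun v => ¬ G.degree v ≤ 4 with hL
  have hb : b ∉ L := by simp [hL, hN]
  -- Including `b` charges its own excess too; each vertex of `L` costs at least 4.
  have h4 := G.sum_degree_sub_one_le hW hG1 hsum (insert b L)
  rw [sum_insert hb] at h4
  have h5 : (#L : ℝ) * 4 ≤ ∑ w ∈ L, ((G.degree w : ℝ) - 1) := by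
    rw [← nsmul_eq_mul]
    refine card_nsmul_le_sum _ _ _ fun w hw => ?_
    have : 5 ≤ G.degree w := by
      have := (mem_filter.1 hw).2
      omega
    have : (5 : ℝ) ≤ G.degree w := by exact_mod_cast this
    linarith
  have h1' : (#N : ℝ) + G.degree b + 1 = n := by exact_mod_cast h1
  have h2' : (#(N.filter fun v => G.degree v ≤ 4) : ℝ) + #L = #N := by exact_mod_cast h2
  have h3' : (#(N.filter fun v => G.degree v ≤ 4) : ℝ) ≤ #{v | G.degree v ≤ 4 ∧ ¬ G.Adj b v} := by
    exact_mod_cast h3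
  linarith

/-- If `b` is not adjacent to too few vertices, then `D` of these are independent. -/
theorem exists_isIndepSet_not_adj (hW : Fintype.card W = n) (hG1 : ∀ w, 1 ≤ G.degree w)
    (hsum : ∑ w, (G.degree w : ℝ) ≤ 2 * n + 2 * m) (hm : 5 * D ≤ m) (b : W)
    (hb : (G.degree b : ℝ) < n - m) :
    ∃ I : Finset W, G.IsIndepSet I ∧ D ≤ #I ∧ ∀ v ∈ I, v ≠ b ∧ ¬ G.Adj b v := by
  set N : Finset W := {v | v ≠ b ∧ ¬ G.Adj b v} with hN
  obtain ⟨I, hIN, hI, hle⟩ := G.exists_isIndepSet_sum_inv_degree_le N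
  refine ⟨I, hI, ?_, fun v hv => by simpa [hN] using hIN hv⟩
  have h1 := G.card_filter_ne_not_adj_add_degree b
  rw [hW, ← hN] at h1
  have h1' : (#N : ℝ) + G.degree b + 1 = n := by exact_mod_cast h1
  have h2 := G.sum_degree_sub_one_le hW hG1 hsum (insert b N)
  rw [sum_insert (by simp [hN])] at h2
  -- The tangent line to `1 / (d + 1)` at `d = 4` makes the Caro–Wei sum linear in the excess.
  have h3 : ∑ v ∈ N, ((8 : ℝ) / 25 - ((G.degree v : ℝ) - 1) / 25) ≤
      ∑ v ∈ N, (1 : ℝ) / (G.degree v + 1) := by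
    refine sum_le_sum fun v _ => ?_
    rw [le_div_iff₀ (by positivity)]
    nlinarith [sq_nonneg ((G.degree v : ℝ) - 4)]
  rw [sum_sub_distrib, sum_const, nsmul_eq_mul, ← sum_div] at h3
  have hN5 : 5 * D ≤ #N := by
    have : ((5 * D : ℕ) : ℝ) < ((#N + 1 : ℕ) : ℝ) := by push_cast; linarith
    have := Nat.cast_lt.1 this
    omega
  have hN5' : 5 * (D : ℝ) ≤ #N := by exact_mod_cast hN5
  have : (D : ℝ) < ((#I + 1 : ℕ) : ℝ) := by push_cast; linarith
  have := Nat.cast_lt.1 this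
  omega

/-- Independent vertices that can be put next to the images of the vertices of `B`. -/
theorem exists_fillers (hD : 1 ≤ D) (hW : Fintype.card W = n) (hG1 : ∀ w, 1 ≤ G.degree w)
    (hsum : ∑ w, (G.degree w : ℝ) ≤ 2 * n + 2 * m) (hnm : (n : ℝ) = 12 * (2 * D + 1) * m)
    (hm : 5 * D ≤ m) (hΔ : ∀ w, (G.degree w : ℝ) < n - m) (B : Finset W) (b₁ : W) (hb₁ : b₁ ∈ B)
    (hmax : ∀ w, G.degree w ≤ G.degree b₁) (hB : ∀ b ∈ B, b ≠ b₁ → n < 3 * D * G.degree b)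
    (X : Finset V) (β : V → W) (hβ : ∀ x ∈ X, β x ∈ B) (hX : #X ≤ 3 * D * D)
    (hX₁ : #{x ∈ X | β x = b₁} ≤ D) :
    ∃ p : V → W, Set.InjOn p X ∧ (∀ x ∈ X, p x ∉ B ∧ ¬ G.Adj (β x) (p x)) ∧
      ∀ x ∈ X, ∀ y ∈ X, ¬ G.Adj (p x) (p y) := by
  have hD' : (1 : ℝ) ≤ D := by exact_mod_cast hD
  -- If `B = {b₁}`, few non-neighbours of `b₁` may exist, but only `D` fillers are needed. Otherwise
  -- a second vertex of `B` has degree above `n / (3D) > 8m`, which forces `b₁` to miss many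
  -- vertices of degree at most 4.
  by_cases hB1 : ∀ b ∈ B, b = b₁
  · obtain ⟨I, hI, hDI, hIb⟩ := G.exists_isIndepSet_not_adj hW hG1 hsum hm b₁ (hΔ b₁)
    have hXI : #X ≤ #I := by
      rw [filter_true_of_mem fun x hx => hB1 _ (hβ x hx)] at hX₁
      exact hX₁.trans hDI
    obtain ⟨f⟩ := Function.Embedding.nonempty_of_card_le (α := X) (β := I) (by simpa using hXI)
    have hf : ∀ x (hx : x ∈ X), (if h : x ∈ X then (f ⟨x, h⟩ : W) else b₁) = f ⟨x, hx⟩ :=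
      fun x hx => by simp [hx]
    refine ⟨fun x => if h : x ∈ X then (f ⟨x, h⟩ : W) else b₁, ?_, ?_, ?_⟩
    · intro x hx y hy hxy
      simp only [hf x hx, hf y hy] at hxy
      simpa using f.injective (Subtype.ext hxy)
    · intro x hx
      simp only [hf x hx]
      have := hIb _ (f ⟨x, hx⟩).2
      rw [hB1 _ (hβ x hx)]
      exact ⟨fun h => this.1 (hB1 _ h), this.2⟩
    · intro x hx y hy
      simp only [hf x hx, hf y hy]
      intro h
      exact hI (f ⟨x, hx⟩).2 (f ⟨y, hy⟩).2 h.ne h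
  · push Not at hB1
    obtain ⟨b₂, hb₂, hb₂₁⟩ := hB1
    have hdeg : ∀ b ∈ B, b ≠ b₁ → 8 * m < G.degree b := by
      intro b hb hne
      have h : (n : ℝ) < 3 * D * G.degree b := by exact_mod_cast hB b hb hne
      rw [hnm] at h
      by_contra! hcon
      nlinarith
    have hle : ∀ b, (G.degree b : ℝ) ≤ G.degree b₁ := fun b => by exact_mod_cast hmax b
    have hBdeg : ∀ b ∈ B, 4 < G.degree b := by
      intro b hb
      have : (4 : ℝ) < G.degree b := by
        by_cases h : b = b₁
        · subst h
          linarith [hdeg b₂ hb₂ hb₂₁, hle b₂]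
        · linarith [hdeg b hb h]
      exact_mod_cast this
    have hpair : ∀ b, b ≠ b₁ → (G.degree b : ℝ) + G.degree b₁ ≤ n + 2 * m + 2 := by
      intro b hb
      have := G.sum_degree_sub_one_le hW hG1 hsum {b, b₁}
      rw [sum_pair hb] at this
      linarith
    have hA := G.le_card_degree_le_four_not_adj hW hG1 hsum
    -- A chosen vertex of degree at most 4 excludes at most 5 vertices, itself included. There are
    -- at most `D` places beside `b₁` and `3D²` in all, whence `5D` here and `15D²` below.
    have hA₁ : 5 * D < #{v | G.degree v ≤ 4 ∧ ¬ G.Adj b₁ v} := by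
      have : (5 * D : ℝ) < #{v | G.degree v ≤ 4 ∧ ¬ G.Adj b₁ v} := by
        linarith [hA b₁, hpair b₂ hb₂₁, hdeg b₂ hb₂ hb₂₁]
      exact_mod_cast this
    have hA₂ : ∀ b, b ≠ b₁ → 15 * D * D < #{v | G.degree v ≤ 4 ∧ ¬ G.Adj b v} := by
      intro b hb
      have : (15 * D * D : ℝ) < #{v | G.degree v ≤ 4 ∧ ¬ G.Adj b v} := by
        have h1 : 36 * m ≤ n := by rw [hnm]; nlinarith
        have h2 : 120 * (D : ℝ) * D + 60 * D ≤ n := by rw [hnm]; nlinarith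
        nlinarith [hA b, hpair b hb, hle b]
      exact_mod_cast this
    let R : W → W → Prop := fun a y => a = y ∨ G.Adj a y
    have hRsymm : ∀ a b, R a b → R b a := fun a b h => h.imp Eq.symm Adj.symm
    let T : Finset W := {v | G.degree v ≤ 4}
    have hR : ∀ a ∈ T, #{y | R a y} ≤ 5 := by
      intro a ha
      have h1 : ({y | R a y} : Finset W) ⊆ insert a (G.neighborFinset a) := by
        intro y
        simp only [R, mem_filter, mem_univ, true_and, mem_insert, mem_neighborFinset]
        exact Or.imp_left Eq.symm
      have h2 := card_le_card h1
      have h3 := card_insert_le a (G.neighborFinset a)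
      have h4 : G.degree a ≤ 4 := by simpa [T] using ha
      rw [card_neighborFinset_eq_degree] at h3
      omega
    let A : V → Finset W := fun x => {v | G.degree v ≤ 4 ∧ ¬ G.Adj (β x) v}
    have hAT : ∀ x, A x ⊆ T := fun x v => by simp only [A, T, mem_filter]; tauto
    obtain ⟨p, hp1, hp2, -⟩ := exists_pairwise_unrelated_choice R hRsymm 5 T ∅ hR (by simp) A
      (X.filter fun x => β x = b₁) (fun x _ => hAT x) (fun x hx => by
        simp only [A, (mem_filter.1 hx).2, card_empty]
        omega) (fun _ => b₁)
    obtain ⟨q, hq1, hq2, hq3⟩ := exists_pairwise_unrelated_choice R hRsymm 5 T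
      ((X.filter fun x => β x = b₁).image p) hR
      (image_subset_iff.2 fun x hx => hAT x (hp1 x hx)) A
      (X.filter fun x => ¬ β x = b₁) (fun x _ => hAT x) (fun x hx => by
        have h1 := hA₂ _ (mem_filter.1 hx).2
        have h2 := card_filter_add_card_filter_not (s := X) (fun x => β x = b₁)
        have h3 := card_image_le (s := X.filter fun x => β x = b₁) (f := p)
        simp only [A]
        linarith) (fun _ => b₁)
    let r : V → W := fun x => if β x = b₁ then p x else q x
    have hr1 : ∀ x ∈ X, r x ∈ A x := by
      intro x hx
      by_cases h : β x = b₁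
      · simpa [r, h] using hp1 x (by simp [hx, h])
      · simpa [r, h] using hq1 x (by simp [hx, h])
    have hr2 : ∀ x ∈ X, ∀ y ∈ X, x ≠ y → ¬ R (r x) (r y) := by
      intro x hx y hy hxy
      by_cases h : β x = b₁ <;> by_cases h' : β y = b₁
      · simpa [r, h, h'] using hp2 x (by simp [hx, h]) y (by simp [hy, h']) hxy
      · simpa [r, h, h'] using
          hq3 y (by simp [hy, h']) (p x) (mem_image_of_mem _ (by simp [hx, h]))
      · simpa [r, h, h'] using fun hh =>
          hq3 x (by simp [hx, h]) (p y) (mem_image_of_mem _ (by simp [hy, h'])) (hRsymm _ _ hh)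
      · simpa [r, h, h'] using hq2 x (by simp [hx, h]) y (by simp [hy, h']) hxy
    refine ⟨r, ?_, ?_, ?_⟩
    · intro x hx y hy hxy
      by_contra hne
      exact hr2 x hx y hy hne (Or.inl hxy)
    · intro x hx
      have := hr1 x hx
      simp only [A, mem_filter, mem_univ, true_and] at this
      exact ⟨fun h => absurd (hBdeg _ h) (by omega), this.2⟩
    · intro x hx y hy hadj
      refine hr2 x hx y hy ?_ (Or.inr hadj)
      rintro rfl
      exact hadj.ne rfl

end Fillers

/-! ### Placing the large vertices and assembling the packing. -/

section Packing

variable {V W : Type*} {D n : ℕ} {m : ℝ}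

/-- Few vertices have degree larger than `n / (3 * D)`. -/
theorem card_degree_large_le [Fintype W] (G : SimpleGraph W) [DecidableRel G.Adj] (hD : 1 ≤ D)
    (hW : Fintype.card W = n) (hG1 : ∀ w, 1 ≤ G.degree w)
    (hsum : ∑ w, (G.degree w : ℝ) ≤ 2 * n + 2 * m) (hnm : (n : ℝ) = 12 * (2 * D + 1) * m)
    (hm : 5 * D ≤ m) : #{w | n < 3 * D * G.degree w} ≤ 3 * D := by
  have hD' : (1 : ℝ) ≤ D := by exact_mod_cast hD
  set T : Finset W := {w | n < 3 * D * G.degree w} with hT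
  -- `3D + 1` such vertices would have total excess above `n + n / (3D) - 3D - 1`, which exceeds `n
  -- + 2m`.
  by_contra! hcon
  have hcon' : 3 * (D : ℝ) + 1 ≤ #T := by exact_mod_cast hcon
  have h1 := G.sum_degree_sub_one_le hW hG1 hsum T
  have h2 : (#T : ℝ) * (n - 3 * D) ≤ ∑ w ∈ T, 3 * D * ((G.degree w : ℝ) - 1) := by
    rw [← nsmul_eq_mul]
    refine card_nsmul_le_sum _ _ _ fun w hw => ?_
    have : (n : ℝ) < 3 * D * G.degree w := by exact_mod_cast (mem_filter.1 hw).2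
    linarith
  rw [← mul_sum] at h2
  have h3 : 120 * (D : ℝ) * D + 60 * D ≤ n := by rw [hnm]; nlinarith
  have h4 : (3 * (D : ℝ) + 1) * (n - 3 * D) ≤ #T * (n - 3 * D) :=
    mul_le_mul_of_nonneg_right hcon' (by nlinarith)
  have h5 : 3 * (D : ℝ) * ∑ w ∈ T, ((G.degree w : ℝ) - 1) ≤ 3 * D * (n + 2 * m) :=
    mul_le_mul_of_nonneg_left h1 (by positivity)
  nlinarith

/-- Vertices can be placed with pairwise disjoint closed neighbourhoods. -/
theorem exists_disjoint_closed_neighborhoods [Fintype V] [DecidableEq V]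
    [DecidableEq W] (H : SimpleGraph V) [DecidableRel H.Adj]
    (hH : ∀ x, H.degree x ≤ D) (B : Finset W) (hB : (D + 1) * (D + 1) * #B < Fintype.card V) :
    ∃ g : W → V, ∀ b ∈ B, ∀ b' ∈ B, b ≠ b' →
      Disjoint (insert (g b) (H.neighborFinset (g b))) (insert (g b') (H.neighborFinset (g b'))) := by
  let C : V → Finset V := fun x => insert x (H.neighborFinset x)
  have hC : ∀ x, #(C x) ≤ D + 1 := fun x => by
    refine (card_insert_le _ _).trans ?_
    rw [card_neighborFinset_eq_degree]
    exact Nat.succ_le_succ (hH x)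
  have hCsymm : ∀ x z, z ∈ C x → x ∈ C z := fun x z h => by
    simpa [C, eq_comm, H.adj_comm] using h
  obtain ⟨x₀⟩ : Nonempty V := Fintype.card_pos_iff.1 (by omega)
  obtain ⟨g, -, hg, -⟩ := exists_pairwise_unrelated_choice (fun x y => ¬ Disjoint (C x) (C y))
    (fun x y h h' => h h'.symm) ((D + 1) * (D + 1)) univ ∅ (fun x _ => by
      refine (card_le_card (t := (C x).biUnion C) fun y hy => ?_).trans
        ((card_biUnion_le_card_mul _ _ (D + 1) fun z _ => hC z).trans
          (Nat.mul_le_mul_right _ (hC x)))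
      obtain ⟨z, hz, hz'⟩ := not_disjoint_iff.1 (mem_filter.1 hy).2
      exact mem_biUnion.2 ⟨z, hz, hCsymm _ _ hz'⟩) (by simp) (fun _ => univ) B (by simp)
    (fun _ _ => by simpa using hB) (fun _ => x₀)
  exact ⟨g, fun b hb b' hb' hne => not_not.1 (hg b hb b' hb' hne)⟩

/-- A sparse graph without isolated vertices, of not too large maximum degree, can be packed with
a graph of small maximum degree. -/
theorem exists_equiv_forall_not_adj_of_sparse [Fintype V] [DecidableEq V] [Fintype W]
    [DecidableEq W] (H : SimpleGraph V) [DecidableRel H.Adj] (G : SimpleGraph W) [DecidableRel G.Adj] (hD : 1 ≤ D) (hV : Fintype.card V = n)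
    (hW : Fintype.card W = n) (hH : ∀ x, H.degree x ≤ D) (hG1 : ∀ w, 1 ≤ G.degree w)
    (hsum : ∑ w, (G.degree w : ℝ) ≤ 2 * n + 2 * m) (hΔ : ∀ w, (G.degree w : ℝ) < n - m)
    (hnm : (n : ℝ) = 12 * (2 * D + 1) * m) (hn₁ : 6 * (D + 1) ^ 3 ≤ n)
    (hn₂ : 120 * D ^ 2 + 60 * D ≤ n) :
    ∃ e : V ≃ W, ∀ x y, H.Adj x y → ¬ G.Adj (e x) (e y) := by
  have hD' : (1 : ℝ) ≤ D := by exact_mod_cast hD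
  have hm : 5 * D ≤ m := by
    have : (120 : ℝ) * D ^ 2 + 60 * D ≤ n := by exact_mod_cast hn₂
    rw [hnm] at this
    by_contra! hcon
    nlinarith
  have hn0 : 0 < n := by nlinarith
  obtain ⟨w₀⟩ : Nonempty W := Fintype.card_pos_iff.1 (by omega)
  have : Nonempty W := ⟨w₀⟩
  obtain ⟨b₁, -, hb₁⟩ := exists_max_image univ (fun w => G.degree w) ⟨w₀, mem_univ _⟩
  have hmax : ∀ w, G.degree w ≤ G.degree b₁ := fun w => hb₁ w (mem_univ w)
  -- If any vertex passes the threshold, so does `b₁`; thus the insertion only matters when none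
  -- does.
  let B : Finset W := insert b₁ ({w | n < 3 * D * G.degree w} : Finset W)
  have hBcard : #B ≤ 3 * D := by
    have h := G.card_degree_large_le hD hW hG1 hsum hnm hm
    rcases ({w | n < 3 * D * G.degree w} : Finset W).eq_empty_or_nonempty with h0 | ⟨w, hw⟩
    · simp only [B, h0, insert_empty_eq, card_singleton]
      omega
    · have : b₁ ∈ ({w | n < 3 * D * G.degree w} : Finset W) := by
        simp only [mem_filter, mem_univ, true_and] at hw ⊢
        exact hw.trans_le (Nat.mul_le_mul_left _ (hmax w))
      simpa only [B, insert_eq_of_mem this] using h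
  obtain ⟨g, hg⟩ := H.exists_disjoint_closed_neighborhoods hH B (by
    rw [hV]
    have := Nat.mul_le_mul_left ((D + 1) * (D + 1)) hBcard
    nlinarith)
  have hgd : ∀ b ∈ B, ∀ b' ∈ B, ∀ x, (x = g b ∨ H.Adj (g b) x) → (x = g b' ∨ H.Adj (g b') x) →
      b = b' := by
    intro b hb b' hb' x h h'
    by_contra hne
    exact Finset.disjoint_left.1 (hg b hb b' hb' hne) (by simpa using h) (by simpa using h')
  have hginj : Set.InjOn g B := fun b hb b' hb' h => hgd b hb b' hb' (g b) (Or.inl rfl) (Or.inl h)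
  let X : Finset V := B.biUnion fun b => H.neighborFinset (g b)
  have hXmem : ∀ x, x ∈ X ↔ ∃ b ∈ B, H.Adj (g b) x := fun x => by simp [X]
  have hβ' : ∀ x, ∃ b, x ∈ X → b ∈ B ∧ H.Adj (g b) x := fun x => by
    by_cases hx : x ∈ X
    · obtain ⟨b, hb⟩ := (hXmem x).1 hx
      exact ⟨b, fun _ => hb⟩
    · exact ⟨b₁, fun h => absurd h hx⟩
  choose β hβ using hβ'
  have hgX : ∀ b ∈ B, g b ∉ X := fun b hb h => by
    obtain ⟨b', hb', h'⟩ := (hXmem _).1 h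
    obtain rfl := hgd b hb b' hb' (g b) (Or.inl rfl) (Or.inr h')
    exact h'.ne rfl
  have hXcard : #X ≤ 3 * D * D :=
    (card_biUnion_le_card_mul _ _ D fun b _ => by simpa using hH _).trans
      (Nat.mul_le_mul_right _ hBcard)
  obtain ⟨p, hp1, hp2, hp3⟩ := G.exists_fillers hD hW hG1 hsum hnm hm hΔ B b₁ (by simp [B]) hmax
    (fun b hb hne => by simpa [B, hne] using hb) X β (fun x hx => (hβ x hx).1) hXcard (by
      refine (card_le_card (t := H.neighborFinset (g b₁)) fun x hx => ?_).trans (by simpa using hH _)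
      obtain ⟨hx, rfl⟩ := mem_filter.1 hx
      simpa using (hβ x hx).2)
  have hinv : ∀ b ∈ B, Function.invFunOn g B (g b) = b := fun b hb => hginj.leftInvOn_invFunOn hb
  let q : V → W := fun y => if y ∈ X then p y else Function.invFunOn g B y
  have hqX : ∀ x ∈ X, q x = p x := fun x hx => by simp [q, hx]
  have hqB : ∀ b ∈ B, q (g b) = b := fun b hb => by simpa [q, hgX b hb] using hinv b hb
  let Y : Finset V := B.image g ∪ X
  have hYmem : ∀ y ∈ Y, (∃ b ∈ B, g b = y) ∨ y ∈ X := fun y hy => by simpa [Y] using hy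
  have hqY : Set.InjOn q Y := by
    intro y hy z hz hyz
    rcases hYmem y hy with ⟨b, hb, rfl⟩ | hy <;> rcases hYmem z hz with ⟨c, hc, rfl⟩ | hz
    · rw [hqB b hb, hqB c hc] at hyz
      rw [hyz]
    · rw [hqB b hb, hqX z hz] at hyz
      exact absurd (hyz ▸ hb) (hp2 z hz).1
    · rw [hqB c hc, hqX y hy] at hyz
      exact absurd (hyz ▸ hc) (hp2 y hy).1
    · rw [hqX y hy, hqX z hz] at hyz
      exact hp1 hy hz hyz
  obtain ⟨e₁, he₁⟩ := exists_equiv_extend_of_card_eq (t := (univ : Finset W))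
    (by rw [card_univ, hV, hW]) (subset_univ (Y.image q)) hqY
  let e₀ : V ≃ W := e₁.trans (Equiv.subtypeUnivEquiv mem_univ)
  have he₀ : ∀ y ∈ Y, e₀ y = q y := fun y hy => he₁ y hy
  have hgY : ∀ b ∈ B, g b ∈ Y := fun b hb => mem_union_left _ (mem_image_of_mem g hb)
  have hXY : ∀ x ∈ X, x ∈ Y := fun x hx => mem_union_right _ hx
  have he₀B : ∀ b ∈ B, e₀ (g b) = b := fun b hb => (he₀ _ (hgY b hb)).trans (hqB b hb)
  have he₀X : ∀ x ∈ X, e₀ x = p x := fun x hx => (he₀ _ (hXY x hx)).trans (hqX x hx)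
  have hpre : ∀ x, e₀ x ∈ B → g (e₀ x) = x := fun x hx => e₀.injective (he₀B _ hx)
  have hBX : ∀ b ∈ B, ∀ x ∈ X, H.Adj (g b) x → ¬ G.Adj b (p x) := by
    intro b hb x hx hadj
    obtain rfl := hgd b hb (β x) (hβ x hx).1 x (Or.inr hadj) (Or.inr (hβ x hx).2)
    exact (hp2 x hx).2
  refine exists_equiv_forall_not_adj_of_switching H G D (n / (3 * D)) hH Y B ?_ ?_ e₀ ?_ ?_ ?_
  · intro w hw
    rw [Nat.le_div_iff_mul_le (by omega), mul_comm]
    by_contra! hcon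
    exact hw (mem_insert_of_mem (by simpa using hcon))
  · have h1 := Nat.div_mul_le_self n (3 * D)
    have h2 := card_union_le (B.image g) X
    have h3 := card_image_le (s := B) (f := g)
    have h4 : #Y ≤ 3 * D + 3 * D * D := by
      simp only [Y]
      omega
    rw [hV]
    nlinarith
  · intro x hx y hy hadj
    rcases hYmem x hx with ⟨b, hb, rfl⟩ | hx <;> rcases hYmem y hy with ⟨c, hc, rfl⟩ | hy
    · obtain rfl := hgd b hb c hc (g c) (Or.inr hadj) (Or.inl rfl)
      exact absurd rfl hadj.ne
    · rw [he₀B b hb, he₀X y hy]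
      exact hBX b hb y hy hadj
    · rw [he₀B c hc, he₀X x hx]
      exact fun h => hBX c hc x hx hadj.symm h.symm
    · rw [he₀X x hx, he₀X y hy]
      exact hp3 x hx y hy
  · intro x hx
    rw [← hpre x hx]
    exact hgY _ hx
  · intro x hx y hadj
    refine hXY y ((hXmem y).2 ⟨e₀ x, hx, ?_⟩)
    rwa [hpre x hx]

end Packing

end SimpleGraph

/-! ### From packing to containment. -/

theorem mainTheorem3 {V W : Type*} [Fintype V] [Fintype W] [DecidableEq W]
    (k n : ℕ) (hk : 1 ≤ k)
    (hn : max (6 * (k : ℝ) ^ 3) (120 * (k : ℝ) ^ 2 - 180 * (k : ℝ) + 60) ≤ (n : ℝ))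
    (F : SimpleGraph V) [DecidableRel F.Adj]
    (hFn : Fintype.card V = n)
    (hFδ : (n : ℝ) - (k : ℝ) ≤ (F.minDegree : ℝ))
    (G : SimpleGraph W) [DecidableRel G.Adj]
    (hGn : Fintype.card W = n)
    (hGconn : G.Connected)
    (hGe : (G.edgeFinset.card : ℝ) ≤ (n : ℝ) * (1 + 1 / (24 * (k : ℝ) - 12)))
    (hGΔ : (G.maxDegree : ℝ) < (n : ℝ) * (1 - 1 / (24 * (k : ℝ) - 12))) :
    G.IsContained F := by
  classical
  obtain ⟨D, rfl⟩ : ∃ D, k = D + 1 := ⟨k - 1, by omega⟩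
  obtain ⟨hn₁, hn₂⟩ := max_le_iff.1 hn
  push_cast at hn₁ hn₂ hGe hGΔ hFδ
  have hn₁' : 6 * (D + 1) ^ 3 ≤ n := by exact_mod_cast hn₁
  -- The second bound on `n` rewritten in `D`: it is exactly `5D ≤ m`.
  have hn₂' : 120 * D ^ 2 + 60 * D ≤ n := by
    have : (120 : ℝ) * D ^ 2 + 60 * D ≤ n := by linarith
    exact_mod_cast this
  have hH : ∀ x, Fᶜ.degree x ≤ D := by
    intro x
    have h1 : n ≤ F.minDegree + (D + 1) := by
      have : (n : ℝ) ≤ F.minDegree + (D + 1) := by linarith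
      exact_mod_cast this
    have h2 := F.minDegree_le_degree x
    rw [SimpleGraph.degree_compl, hFn]
    omega
  obtain ⟨e, he⟩ : ∃ e : V ≃ W, ∀ x y, Fᶜ.Adj x y → ¬ G.Adj (e x) (e y) := by
    -- For `D = 0` the complement has no edges and any bijection works.
    rcases Nat.eq_zero_or_pos D with rfl | hD
    · refine ⟨Fintype.equivOfCardEq (hFn.trans hGn.symm), fun x y hxy => absurd (hH x) ?_⟩
      have := (Fᶜ.degree_pos_iff_exists_adj x).2 ⟨y, hxy⟩
      omega
    · have hW6 : 6 ≤ Fintype.card W := by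
        rw [hGn]
        nlinarith [Nat.one_le_pow 3 (D + 1) (by omega)]
      have : Nontrivial W := Fintype.one_lt_card_iff_nontrivial.1 (by omega)
      have hpos : (0 : ℝ) < 12 * (2 * D + 1) := by positivity
      have hM : 24 * ((D : ℝ) + 1) - 12 = 12 * (2 * D + 1) := by ring
      rw [hM] at hGe hGΔ
      refine SimpleGraph.exists_equiv_forall_not_adj_of_sparse
        (m := (n : ℝ) / (12 * (2 * D + 1))) Fᶜ G hD hFn hGn hH (fun w => ?_) ?_ (fun w => ?_)
        (by field_simp) hn₁' hn₂'
      · exact hGconn.preconnected.degree_pos_of_nontrivial w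
      · have h : ∑ w, (G.degree w : ℝ) = 2 * G.edgeFinset.card := by
          exact_mod_cast G.sum_degrees_eq_twice_card_edges
        rw [h]
        have : (n : ℝ) * (1 + 1 / (12 * (2 * D + 1))) = n + n / (12 * (2 * D + 1)) := by ring
        linarith
      · have h : (G.degree w : ℝ) ≤ G.maxDegree := by exact_mod_cast G.degree_le_maxDegree w
        have : (n : ℝ) * (1 - 1 / (12 * (2 * D + 1))) = n - n / (12 * (2 * D + 1)) := by ring
        linarith
  refine ⟨⟨⟨e.symm, fun {a b} hab => ?_⟩, e.symm.injective⟩⟩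
  by_contra hF
  refine he (e.symm a) (e.symm b) ?_ (by simpa using hab)
  rw [SimpleGraph.compl_adj]
  exact ⟨fun h => hab.ne (e.symm.injective h), hF⟩
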